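/- A fuzzy number is a map $u:\mathbb{R}\to[0,1]$ such that the set $[u]_1=\{x:u(x)=1\}$ is non-empty and all cuts $[u]_\alpha=\{x:u(x)\ge\alpha\}$ ($0<\alpha\le 1$) and $[u]_0=\overline{\{x:u(x)>0\}}$ are compact intervals; write $[u]_\alpha=[u^-(\alpha),u^+(\alpha)]$. Let $\mathcal{F}_D(\mathbb{R})$ be the set of fuzzy numbers $u$ whose restriction to $[u]_0$ is continuous and which are differentiable at every point of $(u^-(0),u^+(0))$. For fuzzy numbers $u,v$ and $p>0$ put $$(u\nabla v)(x)=\sup_{y\in\mathbb{R}}\min\{u(y),v(x-y)\},\qquad (p\cdot v)(t)=v(t/p),$$ $$d_\infty(u,v)=\sup_{\alpha\in[0,1]}\max\{|u^-(\alpha)-v^-(\alpha)|,\ |u^+(\alpha)-v^+(\alpha)|\}.$$ A smoother of $u$ is some $\zeta\in\mathcal{F}_D(\mathbb{R})$ with $u\nabla\zeta\in\mathcal{F}_D(\mathbb{R})$. Consider the condition $$(\ast)\qquad \zeta(\zeta^-(0))\le u(u^-(0))\quad\text{and}\quad \zeta(\zeta^+(0))\le u(u^+(0)).$$ **Theorem.**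 Let $u$ be a fuzzy number that is non-differentiable at only finitely many points of $\mathbb{R}$. Then: 1. There is a smoother $\zeta$ of $u$ that satisfies $(\ast)$. 2. If $\zeta$ is a smoother of $u$ that satisfies $(\ast)$, then $p\cdot\zeta$ is a smoother of $u$ for every $p>0$. 3. If $\zeta$ is any smoother of $u$, then for every $p>0$ the function $u\nabla(p\cdot\zeta)$ is a fuzzy number and $$d_\infty\bigl(u,\,u\nabla(p\cdot\zeta)\bigr)\le p\cdot\max\{|\zeta^+(0)|,|\zeta^-(0)|\};$$ consequently $d_\infty(u,u\nabla(p\cdot\zeta))\to 0$ as $p\to 0^+$. In particular there is a smoother $\zeta$ of $u$ all of whose rescalings $p\cdot\zeta$, $p>0$, are smoothers of $u$, and $u\nabla(p\cdot\zeta)\to u$ in $d_\infty$ as $p\to0^+$. -/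

import Mathlib

namespace Fuzzy

open Set Filter Topology

/-- The `α`-cut `[u]_α` of a fuzzy set `u` on `ℝ`: `{x | u x ≥ α}` for `α ≠ 0`, and the closure of
`{x | u x > 0}` for `α = 0`. -/
noncomputable def cut (u : ℝ → ℝ) (α : ℝ) : Set ℝ :=
  open Classical in if α = 0 then closure {x | 0 < u x} else {x | α ≤ u x}

/-- A fuzzy number: a map `ℝ → [0,1]` whose `1`-cut is non-empty and all of whose `α`-cuts,
`α ∈ [0,1]`, are compact intervals. -/
structure IsFuzzyNumber (u : ℝ → ℝ) : Prop where
  mem_unit : ∀ x, u x ∈ Icc (0 : ℝ) 1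
  core_nonempty : (cut u 1).Nonempty
  cut_eq_Icc : ∀ α ∈ Icc (0 : ℝ) 1, ∃ a b : ℝ, cut u α = Icc a b

/-- `u⁻(α)`, the left endpoint of the `α`-cut. -/
noncomputable def lower (u : ℝ → ℝ) (α : ℝ) : ℝ := sInf (cut u α)

/-- `u⁺(α)`, the right endpoint of the `α`-cut. -/
noncomputable def upper (u : ℝ → ℝ) (α : ℝ) : ℝ := sSup (cut u α)

/-- The class `F_D(ℝ)` of differentiable fuzzy numbers: fuzzy numbers that are continuous on
`[u]_0` (relative to `[u]_0`) and differentiable on the open interval `(u⁻(0), u⁺(0))`. -/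
structure IsSmooth (u : ℝ → ℝ) : Prop where
  isFuzzyNumber : IsFuzzyNumber u
  continuousOn : ContinuousOn u (cut u 0)
  differentiableAt : ∀ x ∈ Ioo (lower u 0) (upper u 0), DifferentiableAt ℝ u x

/-- The sup-min convolution `(u ∇ v)(x) = sup_y min (u y) (v (x - y))`. -/
noncomputable def conv (u v : ℝ → ℝ) (x : ℝ) : ℝ := ⨆ y : ℝ, min (u y) (v (x - y))

/-- The product `r · v` of a real number and a fuzzy number: `t ↦ v (t / r)` for `r ≠ 0`, and the
indicator of `{0}` for `r = 0`. -/
noncomputable def scale (r : ℝ) (v : ℝ → ℝ) (t : ℝ) : ℝ :=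
  open Classical in if r = 0 then (if t = 0 then 1 else 0) else v (t / r)

/-- The supremum metric
`d_∞(u,v) = sup_{α ∈ [0,1]} max (|u⁻(α) - v⁻(α)|) (|u⁺(α) - v⁺(α)|)`; for fuzzy numbers the supremum is
over a bounded set, see `bddAbove_dist`. -/
noncomputable def supDist (u v : ℝ → ℝ) : ℝ :=
  ⨆ α : Icc (0 : ℝ) 1,
    max |lower u α - lower v α| |upper u α - upper v α|

/-- `ζ` is a smoother of the fuzzy number `u`: both `ζ` and `u ∇ ζ` belong to `F_D(ℝ)`. -/
def IsSmoother (u ζ : ℝ → ℝ) : Prop := IsSmooth ζ ∧ IsSmooth (conv u ζ)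

/-- At the two endpoints of its support interval, `ζ` takes values not exceeding those taken by `u`
at the endpoints of its own: `ζ(ζ⁻(0)) ≤ u(u⁻(0))` and `ζ(ζ⁺(0)) ≤ u(u⁺(0))`. -/
def EndpointLE (ζ u : ℝ → ℝ) : Prop :=
  ζ (lower ζ 0) ≤ u (lower u 0) ∧ ζ (upper ζ 0) ≤ u (upper u 0)

lemma cut_subset_zero {u : ℝ → ℝ} {α : ℝ} (hα : α ∈ Icc (0 : ℝ) 1) : cut u α ⊆ cut u 0 := by
  rcases eq_or_lt_of_le hα.1 with h | h
  · rw [← h]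
  · intro x hx
    rw [cut, if_neg h.ne'] at hx
    rw [cut, if_pos rfl]
    exact subset_closure (lt_of_lt_of_le h hx)

lemma one_cut_subset {u : ℝ → ℝ} {α : ℝ} (hα : α ∈ Icc (0 : ℝ) 1) : cut u 1 ⊆ cut u α := by
  rcases eq_or_lt_of_le hα.1 with h | h
  · rw [← h]; exact cut_subset_zero (by simp)
  · intro x hx
    rw [cut, if_neg one_ne_zero] at hx
    rw [cut, if_neg h.ne']
    exact le_trans hα.2 hx

/-- For a fuzzy number, `[u]_α = [u⁻(α), u⁺(α)]`, a non-empty interval contained in `[u]_0`. -/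
lemma IsFuzzyNumber.cut_eq {u : ℝ → ℝ} (hu : IsFuzzyNumber u) {α : ℝ} (hα : α ∈ Icc (0 : ℝ) 1) :
    lower u α ≤ upper u α ∧ cut u α = Icc (lower u α) (upper u α) := by
  obtain ⟨a, b, h⟩ := hu.cut_eq_Icc α hα
  have hne : (cut u α).Nonempty := hu.core_nonempty.mono (one_cut_subset hα)
  rw [h, nonempty_Icc] at hne
  rw [lower, upper, h, csInf_Icc hne, csSup_Icc hne]
  exact ⟨hne, rfl⟩

/-- The supremum defining `supDist` is over a bounded set when both arguments are fuzzy numbers. -/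
lemma bddAbove_dist {u v : ℝ → ℝ} (hu : IsFuzzyNumber u) (hv : IsFuzzyNumber v) :
    BddAbove (range fun α : Icc (0 : ℝ) 1 =>
      max |lower u α - lower v α| |upper u α - upper v α|) := by
  have key : ∀ {w : ℝ → ℝ}, IsFuzzyNumber w → ∀ α ∈ Icc (0 : ℝ) 1,
      lower w 0 ≤ lower w α ∧ lower w α ≤ upper w α ∧ upper w α ≤ upper w 0 := by
    intro w hw α hα
    have h0 := hw.cut_eq (α := 0) (by simp)
    have h1 := hw.cut_eq hα
    have hs := cut_subset_zero (u := w) hα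
    rw [h0.2, h1.2, Icc_subset_Icc_iff h1.1] at hs
    exact ⟨hs.1, h1.1, hs.2⟩
  refine ⟨|lower u 0| + |upper u 0| + |lower v 0| + |upper v 0|, ?_⟩
  rintro _ ⟨α, rfl⟩
  obtain ⟨a1, a2, a3⟩ := key hu α α.2
  obtain ⟨b1, b2, b3⟩ := key hv α α.2
  have := neg_abs_le (lower u 0)
  have := le_abs_self (upper u 0)
  have := neg_abs_le (lower v 0)
  have := le_abs_self (upper v 0)
  have := abs_nonneg (lower u 0)
  have := abs_nonneg (upper u 0)
  have := abs_nonneg (lower v 0)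
  have := abs_nonneg (upper v 0)
  refine max_le ?_ ?_ <;> rw [abs_le] <;> constructor <;> linarith

end Fuzzy

namespace Fuzzy

open Set Filter Topology

variable {u v : ℝ → ℝ} {α β x y z : ℝ}

/-! ### Cuts of a fuzzy number -/

/-! Cuts of a sup-min convolution are sums of cuts (`cut_conv`), so the endpoints of `conv u (scale
p ζ)` differ from those of `u` by `p` times those of `ζ`; this gives the distance estimate.

For smoothness, complete each graph by vertical segments at the jumps. Every point `x` of the
support of `f = conv u v` splits as `x = Y x + Z x` with `(Y x, f x)` and `(Z x, f x)` on the
completed graphs of `u` and `v`, and the splitting can be made with `Y` and `Z` both monotone, hence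
1-Lipschitz (`exists_monotoneSelection`). If `v` is continuous on its support, the only vertical
segments of its completed graph are at the ends of the support; the endpoint condition keeps `Z` off
their lower parts, so `f = v ∘ Z` (`MonotoneSelection.conv_eq_snd`) and `f` is continuous.

Differentiability comes from writing `f` in two ways, `f = v ∘ Z = g ∘ W` with `t = c * Z t + W t`
up to a constant. `Z` and `W` need not be differentiable, but if `v` and `g` have derivatives `b`
and `d`, then either one of these vanishes and so does the derivative of `f`, or the increment of
`t` is `(c / b + 1 / d)` times that of `f` up to a small error, and this can be inverted
(`differentiableAt_of_eq_comp`).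

For rescaling, `g = conv u ζ` and `W = Y + Z / p`: adding the completed graphs of `u` and `ζ` at the
common level gives `f = g ∘ W`, so the possible irregularity of `u` never enters. For existence, `g
= u` and `W = Y` work wherever `u` is differentiable at `Y x`. At one of the finitely many bad
points, either the level of `f` lies strictly inside a jump of `u`, so that `Y` is locally constant
and `f` is locally a translate of `ζ`, or it is one of finitely many exceptional levels, which `ζ`
is built to have as critical values. -/

lemma mem_cut_of_pos (hα : 0 < α) : x ∈ cut u α ↔ α ≤ u x := by
  rw [cut, if_neg hα.ne', mem_ofPred_eq]

lemma mem_cut_zero_of_pos (h : 0 < u x) : x ∈ cut u 0 := by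
  rw [cut, if_pos rfl]
  exact subset_closure h

namespace IsFuzzyNumber

lemma nonneg (hu : IsFuzzyNumber u) (x : ℝ) : 0 ≤ u x := (hu.mem_unit x).1

lemma le_one (hu : IsFuzzyNumber u) (x : ℝ) : u x ≤ 1 := (hu.mem_unit x).2

lemma le_of_mem_cut (hu : IsFuzzyNumber u) (hα : 0 ≤ α) (h : x ∈ cut u α) : α ≤ u x := by
  rcases hα.eq_or_lt with rfl | hα
  · exact hu.nonneg x
  · exact (mem_cut_of_pos hα).1 h

lemma mem_cut_self (hu : IsFuzzyNumber u) (h : x ∈ cut u 0) : x ∈ cut u (u x) := by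
  rcases (hu.nonneg x).eq_or_lt with h0 | h0
  · rwa [← h0]
  · exact (mem_cut_of_pos h0).2 le_rfl

lemma lower_le_upper (hu : IsFuzzyNumber u) (hα : α ∈ Icc (0 : ℝ) 1) :
    lower u α ≤ upper u α := (hu.cut_eq hα).1

lemma mem_cut_iff (hu : IsFuzzyNumber u) (hα : α ∈ Icc (0 : ℝ) 1) :
    x ∈ cut u α ↔ lower u α ≤ x ∧ x ≤ upper u α := by
  rw [(hu.cut_eq hα).2, mem_Icc]

lemma lower_mem (hu : IsFuzzyNumber u) (hα : α ∈ Icc (0 : ℝ) 1) : lower u α ∈ cut u α :=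
  (hu.mem_cut_iff hα).2 ⟨le_rfl, hu.lower_le_upper hα⟩

lemma upper_mem (hu : IsFuzzyNumber u) (hα : α ∈ Icc (0 : ℝ) 1) : upper u α ∈ cut u α :=
  (hu.mem_cut_iff hα).2 ⟨hu.lower_le_upper hα, le_rfl⟩

lemma one_mem_unit : (1 : ℝ) ∈ Icc (0 : ℝ) 1 := by simp

lemma zero_mem_unit : (0 : ℝ) ∈ Icc (0 : ℝ) 1 := by simp

lemma apply_lower_one (hu : IsFuzzyNumber u) : u (lower u 1) = 1 :=
  le_antisymm (hu.le_one _) (hu.le_of_mem_cut zero_le_one (hu.lower_mem one_mem_unit))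

lemma apply_upper_one (hu : IsFuzzyNumber u) : u (upper u 1) = 1 :=
  le_antisymm (hu.le_one _) (hu.le_of_mem_cut zero_le_one (hu.upper_mem one_mem_unit))

lemma lower_zero_le (hu : IsFuzzyNumber u) (hα : α ∈ Icc (0 : ℝ) 1) : lower u 0 ≤ lower u α :=
  ((hu.mem_cut_iff zero_mem_unit).1 (cut_subset_zero hα (hu.lower_mem hα))).1

lemma upper_le_zero (hu : IsFuzzyNumber u) (hα : α ∈ Icc (0 : ℝ) 1) : upper u α ≤ upper u 0 :=
  ((hu.mem_cut_iff zero_mem_unit).1 (cut_subset_zero hα (hu.upper_mem hα))).2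

lemma lower_le_one (hu : IsFuzzyNumber u) (hα : α ∈ Icc (0 : ℝ) 1) : lower u α ≤ lower u 1 :=
  ((hu.mem_cut_iff hα).1 (one_cut_subset hα (hu.lower_mem one_mem_unit))).1

lemma one_le_upper (hu : IsFuzzyNumber u) (hα : α ∈ Icc (0 : ℝ) 1) : upper u 1 ≤ upper u α :=
  ((hu.mem_cut_iff hα).1 (one_cut_subset hα (hu.upper_mem one_mem_unit))).2

lemma eq_zero_of_lt_lower (hu : IsFuzzyNumber u) (hx : x < lower u 0) : u x = 0 := by
  by_contra h
  have := mem_cut_zero_of_pos (lt_of_le_of_ne (hu.nonneg x) (Ne.symm h))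
  exact absurd ((hu.mem_cut_iff zero_mem_unit).1 this).1 hx.not_ge

/-- Fuzzy numbers are quasi-concave. -/
lemma min_le_of_between (hu : IsFuzzyNumber u) (hxy : x ≤ y) (hyz : y ≤ z) :
    min (u x) (u z) ≤ u y := by
  rcases (le_min (hu.nonneg x) (hu.nonneg z)).eq_or_lt with h | h
  · rw [← h]; exact hu.nonneg y
  · have hα : min (u x) (u z) ∈ Icc (0 : ℝ) 1 := ⟨h.le, (min_le_left _ _).trans (hu.le_one x)⟩
    have hx := (hu.mem_cut_iff hα).1 ((mem_cut_of_pos h).2 (min_le_left _ _))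
    have hz := (hu.mem_cut_iff hα).1 ((mem_cut_of_pos h).2 (min_le_right _ _))
    exact hu.le_of_mem_cut h.le ((hu.mem_cut_iff hα).2 ⟨hx.1.trans hxy, hyz.trans hz.2⟩)

lemma apply_le_of_le (hu : IsFuzzyNumber u) (hxy : x ≤ y) (hy : y ≤ upper u 1) : u x ≤ u y := by
  have := hu.min_le_of_between hxy hy
  rwa [hu.apply_upper_one, min_eq_left (hu.le_one x)] at this

lemma apply_eq_one_of_mem (hu : IsFuzzyNumber u) (h1 : lower u 1 ≤ x) (h2 : x ≤ upper u 1) :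
    u x = 1 :=
  le_antisymm (hu.le_one x)
    (hu.le_of_mem_cut zero_le_one ((hu.mem_cut_iff one_mem_unit).2 ⟨h1, h2⟩))

/-- The endpoints lie in the closure of the positivity set, so there are points of positivity on
both sides of `x`; quasi-concavity does the rest. -/
lemma pos_of_mem_Ioo (hu : IsFuzzyNumber u) (hx : x ∈ Ioo (lower u 0) (upper u 0)) : 0 < u x := by
  have hl := hu.lower_mem zero_mem_unit
  have hr := hu.upper_mem zero_mem_unit
  rw [cut, if_pos rfl] at hl hr
  obtain ⟨a, ha, ha0⟩ := mem_closure_iff.1 hl (Iio x) isOpen_Iio hx.1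
  obtain ⟨b, hb, hb0⟩ := mem_closure_iff.1 hr (Ioi x) isOpen_Ioi hx.2
  exact (lt_min ha0 hb0).trans_le (hu.min_le_of_between (le_of_lt ha) (le_of_lt hb))

end IsFuzzyNumber

/-! ### Reflection -/

lemma mem_cut_comp_neg : x ∈ cut (fun t => u (-t)) α ↔ -x ∈ cut u α := by
  by_cases hα : α = 0
  · rw [cut, cut, if_pos hα, if_pos hα]
    have := (Homeomorph.neg ℝ).preimage_closure {t | 0 < u t}
    exact (Set.ext_iff.1 this x).symm
  · rw [cut, cut, if_neg hα, if_neg hα]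
    rfl

lemma cut_comp_neg : cut (fun t => u (-t)) α = -cut u α := by
  ext x
  rw [mem_cut_comp_neg, Set.mem_neg]

lemma lower_comp_neg : lower (fun t => u (-t)) α = -upper u α := by
  rw [lower, upper, cut_comp_neg, Real.sInf_def, neg_neg]

lemma upper_comp_neg : upper (fun t => u (-t)) α = -lower u α := by
  rw [lower, upper, cut_comp_neg, Real.sInf_def, neg_neg]

lemma IsFuzzyNumber.comp_neg (hu : IsFuzzyNumber u) : IsFuzzyNumber (fun t => u (-t)) where
  mem_unit x := hu.mem_unit (-x)
  core_nonempty := by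
    rw [cut_comp_neg]
    exact hu.core_nonempty.neg
  cut_eq_Icc α hα := by
    obtain ⟨a, b, h⟩ := hu.cut_eq_Icc α hα
    refine ⟨-b, -a, ?_⟩
    rw [cut_comp_neg, h]
    ext x
    simp only [Set.mem_neg, mem_Icc]
    constructor <;> rintro ⟨h1, h2⟩ <;> constructor <;> linarith

/-- Reflection exchanges the increasing and the decreasing branch. Most right-hand statements below
are deduced through it from their left-hand versions. -/
lemma conv_comp_neg (u v : ℝ → ℝ) :
    conv (fun t => u (-t)) (fun t => v (-t)) = fun x => conv u v (-x) := by
  funext x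
  rw [conv, conv]
  refine (Equiv.neg ℝ).iSup_congr fun y => ?_
  simp only [Equiv.neg_apply]
  congr 2
  ring

/-! ### The sup-min convolution -/

lemma bddAbove_min (hu : IsFuzzyNumber u) (v : ℝ → ℝ) (x : ℝ) :
    BddAbove (range fun y => min (u y) (v (x - y))) := by
  refine ⟨1, ?_⟩
  rintro _ ⟨y, rfl⟩
  exact (min_le_left _ _).trans (hu.le_one y)

lemma min_le_conv (hu : IsFuzzyNumber u) (v : ℝ → ℝ) (y z : ℝ) :
    min (u y) (v z) ≤ conv u v (y + z) := by
  have := le_ciSup (bddAbove_min hu v (y + z)) y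
  simpa [conv] using this

lemma conv_le {c : ℝ} (h : ∀ y z, y + z = x → min (u y) (v z) ≤ c) : conv u v x ≤ c :=
  ciSup_le fun y => h y (x - y) (by ring)

lemma exists_lt_of_lt_conv {c : ℝ} (h : c < conv u v x) :
    ∃ y z, y + z = x ∧ c < u y ∧ c < v z := by
  obtain ⟨y, hy⟩ := exists_lt_of_lt_ciSup h
  exact ⟨y, x - y, by ring, hy.trans_le (min_le_left _ _), hy.trans_le (min_le_right _ _)⟩

lemma exists_add_of_mem_Icc {a b c d : ℝ} (hab : a ≤ b) (hcd : c ≤ d) (h1 : a + c ≤ x)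
    (h2 : x ≤ b + d) : ∃ y z, y + z = x ∧ (a ≤ y ∧ y ≤ b) ∧ (c ≤ z ∧ z ≤ d) := by
  -- Greedy splitting: the first summand takes as much as its own bound and the lower bound `c` of
  -- the other allow.
  refine ⟨min b (x - c), x - min b (x - c), by ring, ⟨le_min hab (by linarith), min_le_left _ _⟩,
    ?_, ?_⟩
  · linarith [min_le_right b (x - c)]
  · rcases min_choice b (x - c) with h | h <;> rw [h] <;> linarith

/-- The supremum defining `conv` is not known to be attained, so the argument leaves room. Slightly
to the left of the cuts both functions are strictly below `α`, and some decomposition of `x` has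
both values above these; monotonicity then places both summands to the right of the shifted
endpoints. -/
lemma lower_add_lower_le_of_le_conv (hu : IsFuzzyNumber u) (hv : IsFuzzyNumber v) (hα0 : 0 < α)
    (hα1 : α ≤ 1) (hx : α ≤ conv u v x) : lower u α + lower v α ≤ x := by
  by_contra! hlt
  have hα : α ∈ Icc (0 : ℝ) 1 := ⟨hα0.le, hα1⟩
  -- Half the gap, so that the two shifts by `δ` add up to exactly the gap.
  set δ := (lower u α + lower v α - x) / 2 with hδ
  have hδ0 : 0 < δ := by linarith
  have below : ∀ {w : ℝ → ℝ}, IsFuzzyNumber w → w (lower w α - δ) < α := by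
    intro w hw
    by_contra! h
    have := ((hw.mem_cut_iff hα).1 ((mem_cut_of_pos hα0).2 h)).1
    linarith
  obtain ⟨y, z, hyz, hy, hz⟩ := exists_lt_of_lt_conv ((max_lt (below hu) (below hv)).trans_le hx)
  have above : ∀ {w : ℝ → ℝ}, IsFuzzyNumber w → ∀ {t : ℝ}, w (lower w α - δ) < w t →
      lower w α - δ < t := by
    intro w hw t ht
    by_contra! h
    refine absurd (hw.apply_le_of_le h ?_) ht.not_ge
    have := hw.lower_le_one hα
    have := hw.lower_le_upper IsFuzzyNumber.one_mem_unit
    linarith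
  have h1 := above hu ((le_max_left _ _).trans_lt hy)
  have h2 := above hv ((le_max_right _ _).trans_lt hz)
  linarith

lemma le_upper_add_upper_of_le_conv (hu : IsFuzzyNumber u) (hv : IsFuzzyNumber v) (hα0 : 0 < α)
    (hα1 : α ≤ 1) (hx : α ≤ conv u v x) : x ≤ upper u α + upper v α := by
  have := lower_add_lower_le_of_le_conv (x := -x) hu.comp_neg hv.comp_neg hα0 hα1
    (by rw [conv_comp_neg]; simpa using hx)
  rw [lower_comp_neg, lower_comp_neg] at this
  linarith

/-- Cuts of a sup-min convolution are sums of cuts. -/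
lemma cut_conv (hu : IsFuzzyNumber u) (hv : IsFuzzyNumber v) (hα : α ∈ Icc (0 : ℝ) 1) :
    cut (conv u v) α = Icc (lower u α + lower v α) (upper u α + upper v α) := by
  rcases hα.1.eq_or_lt with rfl | h0
  · apply Subset.antisymm
    · rw [cut, if_pos rfl]
      refine closure_minimal ?_ isClosed_Icc
      intro x hx
      obtain ⟨y, z, rfl, hy, hz⟩ := exists_lt_of_lt_conv hx
      have h1 := (hu.mem_cut_iff hα).1 (mem_cut_zero_of_pos hy)
      have h2 := (hv.mem_cut_iff hα).1 (mem_cut_zero_of_pos hz)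
      exact ⟨add_le_add h1.1 h2.1, add_le_add h1.2 h2.2⟩
    · rintro x ⟨h1, h2⟩
      obtain ⟨y, z, rfl, hy, hz⟩ := exists_add_of_mem_Icc (hu.lower_le_upper hα)
        (hv.lower_le_upper hα) h1 h2
      have hy' := (hu.mem_cut_iff hα).2 hy
      have hz' := (hv.mem_cut_iff hα).2 hz
      rw [cut, if_pos rfl] at hy' hz' ⊢
      refine map_mem_closure₂ continuous_add hy' hz' fun a ha b hb => ?_
      exact (lt_min ha hb).trans_le (min_le_conv hu v a b)
  · ext x
    rw [mem_cut_of_pos h0]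
    constructor
    · intro h
      exact ⟨lower_add_lower_le_of_le_conv hu hv h0 hα.2 h,
        le_upper_add_upper_of_le_conv hu hv h0 hα.2 h⟩
    · rintro ⟨h1, h2⟩
      obtain ⟨y, z, rfl, hy, hz⟩ := exists_add_of_mem_Icc (hu.lower_le_upper hα)
        (hv.lower_le_upper hα) h1 h2
      exact (le_min (hu.le_of_mem_cut h0.le ((hu.mem_cut_iff hα).2 hy))
        (hv.le_of_mem_cut h0.le ((hv.mem_cut_iff hα).2 hz))).trans (min_le_conv hu v y z)

lemma lower_conv (hu : IsFuzzyNumber u) (hv : IsFuzzyNumber v) (hα : α ∈ Icc (0 : ℝ) 1) :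
    lower (conv u v) α = lower u α + lower v α := by
  rw [lower, cut_conv hu hv hα]
  exact csInf_Icc (add_le_add (hu.lower_le_upper hα) (hv.lower_le_upper hα))

lemma upper_conv (hu : IsFuzzyNumber u) (hv : IsFuzzyNumber v) (hα : α ∈ Icc (0 : ℝ) 1) :
    upper (conv u v) α = upper u α + upper v α := by
  rw [upper, cut_conv hu hv hα]
  exact csSup_Icc (add_le_add (hu.lower_le_upper hα) (hv.lower_le_upper hα))

lemma IsFuzzyNumber.conv (hu : IsFuzzyNumber u) (hv : IsFuzzyNumber v) :
    IsFuzzyNumber (conv u v) where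
  mem_unit x := by
    refine ⟨?_, conv_le fun y z _ => (min_le_left _ _).trans (hu.le_one y)⟩
    have := min_le_conv hu v 0 x
    rw [zero_add] at this
    exact (le_min (hu.nonneg 0) (hv.nonneg x)).trans this
  core_nonempty := by
    rw [cut_conv hu hv one_mem_unit, nonempty_Icc]
    exact add_le_add (hu.lower_le_upper one_mem_unit) (hv.lower_le_upper one_mem_unit)
  cut_eq_Icc α hα := ⟨_, _, cut_conv hu hv hα⟩

/-! ### Rescaling -/

section Scale

variable {p : ℝ}

lemma scale_apply (hp : 0 < p) (v : ℝ → ℝ) (t : ℝ) : scale p v t = v (t / p) := by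
  rw [scale, if_neg hp.ne']

lemma mem_cut_scale (hp : 0 < p) : x ∈ cut (scale p v) α ↔ x / p ∈ cut v α := by
  by_cases hα : α = 0
  · rw [cut, cut, if_pos hα, if_pos hα]
    have := (Homeomorph.mulRight₀ p⁻¹ (inv_ne_zero hp.ne')).preimage_closure {t | 0 < v t}
    have := (Set.ext_iff.1 this x).symm
    simpa [scale_apply hp, div_eq_mul_inv] using this
  · rw [cut, cut, if_neg hα, if_neg hα, mem_ofPred_eq, mem_ofPred_eq, scale_apply hp]

lemma cut_scale (hp : 0 < p) (hv : IsFuzzyNumber v) (hα : α ∈ Icc (0 : ℝ) 1) :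
    cut (scale p v) α = Icc (p * lower v α) (p * upper v α) := by
  ext x
  rw [mem_cut_scale hp, hv.mem_cut_iff hα, mem_Icc, le_div_iff₀' hp, div_le_iff₀' hp]

lemma lower_scale (hp : 0 < p) (hv : IsFuzzyNumber v) (hα : α ∈ Icc (0 : ℝ) 1) :
    lower (scale p v) α = p * lower v α := by
  rw [lower, cut_scale hp hv hα]
  exact csInf_Icc (mul_le_mul_of_nonneg_left (hv.lower_le_upper hα) hp.le)

lemma upper_scale (hp : 0 < p) (hv : IsFuzzyNumber v) (hα : α ∈ Icc (0 : ℝ) 1) :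
    upper (scale p v) α = p * upper v α := by
  rw [upper, cut_scale hp hv hα]
  exact csSup_Icc (mul_le_mul_of_nonneg_left (hv.lower_le_upper hα) hp.le)

lemma IsFuzzyNumber.scale (hv : IsFuzzyNumber v) (hp : 0 < p) : IsFuzzyNumber (scale p v) where
  mem_unit x := by
    rw [scale_apply hp]
    exact hv.mem_unit _
  core_nonempty := by
    rw [cut_scale hp hv one_mem_unit, nonempty_Icc]
    exact mul_le_mul_of_nonneg_left (hv.lower_le_upper one_mem_unit) hp.le
  cut_eq_Icc α hα := ⟨_, _, cut_scale hp hv hα⟩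

lemma IsSmooth.scale (hv : IsSmooth v) (hp : 0 < p) : IsSmooth (scale p v) where
  isFuzzyNumber := hv.isFuzzyNumber.scale hp
  continuousOn := by
    have : Fuzzy.scale p v = v ∘ fun t => t / p := funext fun t => scale_apply hp v t
    rw [this]
    refine hv.continuousOn.comp (by fun_prop) fun t ht => ?_
    rw [← this] at ht
    exact (mem_cut_scale hp).1 ht
  differentiableAt x hx := by
    have : Fuzzy.scale p v = v ∘ fun t => t / p := funext fun t => scale_apply hp v t
    rw [lower_scale hp hv.isFuzzyNumber IsFuzzyNumber.zero_mem_unit,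
      upper_scale hp hv.isFuzzyNumber IsFuzzyNumber.zero_mem_unit] at hx
    rw [this]
    refine DifferentiableAt.comp x (hv.differentiableAt _ ⟨?_, ?_⟩) (by fun_prop)
    · rw [lt_div_iff₀' hp]; exact hx.1
    · rw [div_lt_iff₀' hp]; exact hx.2

lemma EndpointLE.scale (h : EndpointLE v u) (hv : IsFuzzyNumber v) (hp : 0 < p) :
    EndpointLE (scale p v) u := by
  rw [EndpointLE, lower_scale hp hv IsFuzzyNumber.zero_mem_unit,
    upper_scale hp hv IsFuzzyNumber.zero_mem_unit, scale_apply hp, scale_apply hp,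
    mul_div_cancel_left₀ _ hp.ne', mul_div_cancel_left₀ _ hp.ne']
  exact h

/-- Convolving with `p · v` moves a fuzzy number by at most `p` times the radius of the support
of `v`. -/
lemma supDist_conv_scale_le (hu : IsFuzzyNumber u) (hv : IsFuzzyNumber v) (hp : 0 < p) :
    supDist u (conv u (scale p v)) ≤ p * max |upper v 0| |lower v 0| := by
  refine ciSup_le fun ⟨α, hα⟩ => ?_
  dsimp only
  have hv' := hv.scale hp
  rw [lower_conv hu hv' hα, upper_conv hu hv' hα, lower_scale hp hv hα, upper_scale hp hv hα,
    sub_add_cancel_left, sub_add_cancel_left, abs_neg, abs_neg, abs_mul, abs_mul, abs_of_pos hp,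
    ← mul_max_of_nonneg _ _ hp.le]
  refine mul_le_mul_of_nonneg_left ?_ hp.le
  have h1 := hv.lower_zero_le hα
  have h2 := hv.lower_le_upper hα
  have h3 := hv.upper_le_zero hα
  have h4 := (le_abs_self (upper v 0)).trans (le_max_left _ |lower v 0|)
  have h5 := (neg_le_abs (lower v 0)).trans (le_max_right |upper v 0| _)
  refine max_le ?_ ?_ <;> rw [abs_le] <;> constructor <;> linarith

lemma tendsto_supDist_conv_scale (hu : IsFuzzyNumber u) (hv : IsFuzzyNumber v) :
    Tendsto (fun p => supDist u (conv u (scale p v))) (𝓝[>] 0) (𝓝 0) := by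
  have hlim : Tendsto (fun p : ℝ => p * max |upper v 0| |lower v 0|) (𝓝[>] 0) (𝓝 0) := by
    have : Tendsto (fun p : ℝ => p * max |upper v 0| |lower v 0|) (𝓝 0)
        (𝓝 (0 * max |upper v 0| |lower v 0|)) := tendsto_id.mul_const _
    rw [zero_mul] at this
    exact this.mono_left nhdsWithin_le_nhds
  refine tendsto_of_tendsto_of_tendsto_of_le_of_le' tendsto_const_nhds hlim ?_ ?_
  · exact Eventually.of_forall fun p => Real.iSup_nonneg fun α => (abs_nonneg _).trans
      (le_max_left _ _)
  · filter_upwards [self_mem_nhdsWithin] with p hp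
    exact supDist_conv_scale_le hu hv hp

end Scale

/-! ### Completed graphs -/

/-- `(y, α)` lies on the increasing branch of the graph of `u`, completed by vertical segments at
the jumps. -/
def LeftLevel (u : ℝ → ℝ) (y α : ℝ) : Prop := y ∈ cut u α ∧ ∀ t < y, u t ≤ α

/-- `(y, α)` lies on the decreasing branch of the graph of `u`, completed by vertical segments at
the jumps. -/
def RightLevel (u : ℝ → ℝ) (y α : ℝ) : Prop := y ∈ cut u α ∧ ∀ t > y, u t ≤ α

lemma leftLevel_comp_neg : LeftLevel (fun t => u (-t)) y α ↔ RightLevel u (-y) α := by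
  rw [LeftLevel, RightLevel, mem_cut_comp_neg]
  refine and_congr_right fun _ => ⟨fun h t ht => ?_, fun h t ht => h _ (neg_lt_neg ht)⟩
  simpa using h (-t) (by linarith)

lemma IsFuzzyNumber.leftLevel_lower (hu : IsFuzzyNumber u) (hα : α ∈ Icc (0 : ℝ) 1) :
    LeftLevel u (lower u α) α := by
  refine ⟨hu.lower_mem hα, fun t ht => ?_⟩
  rcases hα.1.eq_or_lt with rfl | h0
  · exact (hu.eq_zero_of_lt_lower ht).le
  · by_contra! h
    exact absurd ((hu.mem_cut_iff hα).1 ((mem_cut_of_pos h0).2 h.le)).1 ht.not_ge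

lemma LeftLevel.le_upper_one (h : LeftLevel u y α) (hu : IsFuzzyNumber u)
    (hα : α ∈ Icc (0 : ℝ) 1) : y ≤ upper u 1 := by
  by_contra! hlt
  have h1 := h.2 _ hlt
  rw [hu.apply_upper_one] at h1
  obtain rfl : α = 1 := le_antisymm hα.2 h1
  exact absurd ((hu.mem_cut_iff hα).1 h.1).2 hlt.not_ge

lemma RightLevel.upper_one_le (h : RightLevel u y α) (hu : IsFuzzyNumber u) (hα : α < 1) :
    upper u 1 ≤ y := by
  by_contra! hlt
  have h1 := h.2 _ hlt
  rw [hu.apply_upper_one] at h1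
  exact absurd hα h1.not_gt

/-- Monotonicity of the completed increasing branch between distinct levels: a point strictly left
of `y` cannot have a value above `α`. -/
lemma LeftLevel.le_of_lt (h : LeftLevel u y α) (hu : IsFuzzyNumber u) (hβ : 0 ≤ β)
    (hz : z ∈ cut u β) (hαβ : α < β) : y ≤ z := by
  by_contra! hlt
  have := h.2 _ hlt
  have := hu.le_of_mem_cut hβ hz
  linarith

/-- Completed branches add horizontally: if `a + b < y + z`, then `a < y` or `b < z`, so one of the
two values is at most `α`. -/
lemma LeftLevel.conv (hy : LeftLevel u y α) (hz : LeftLevel v z α) (hu : IsFuzzyNumber u)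
    (hv : IsFuzzyNumber v) (hα : α ∈ Icc (0 : ℝ) 1) : LeftLevel (conv u v) (y + z) α := by
  constructor
  · rw [cut_conv hu hv hα]
    have h1 := (hu.mem_cut_iff hα).1 hy.1
    have h2 := (hv.mem_cut_iff hα).1 hz.1
    exact ⟨add_le_add h1.1 h2.1, add_le_add h1.2 h2.2⟩
  · refine fun t ht => conv_le fun a b hab => ?_
    rcases lt_or_ge a y with h | h
    · exact (min_le_left _ _).trans (hy.2 a h)
    · exact (min_le_right _ _).trans (hz.2 b (by linarith))

lemma RightLevel.conv (hy : RightLevel u y α) (hz : RightLevel v z α) (hu : IsFuzzyNumber u)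
    (hv : IsFuzzyNumber v) (hα : α ∈ Icc (0 : ℝ) 1) : RightLevel (conv u v) (y + z) α := by
  rw [← neg_neg y, ← leftLevel_comp_neg] at hy
  rw [← neg_neg z, ← leftLevel_comp_neg] at hz
  have := hy.conv hz hu.comp_neg hv.comp_neg hα
  rw [conv_comp_neg] at this
  have := leftLevel_comp_neg.1 this
  rwa [neg_add, neg_neg, neg_neg] at this

/-- Where `u` is continuous the completed graph is the graph. -/
lemma LeftLevel.eq_of_continuousWithinAt (h : LeftLevel u y α) (hu : IsFuzzyNumber u)
    (hα : 0 ≤ α) {a : ℝ} (hay : a < y) (hc : ContinuousWithinAt u (Ioo a y) y) : u y = α := by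
  refine le_antisymm ?_ (hu.le_of_mem_cut hα h.1)
  have : (𝓝[Ioo a y] y).NeBot := by
    rw [nhdsWithin_Ioo_eq_nhdsLT hay]
    infer_instance
  refine le_of_tendsto hc ?_
  filter_upwards [self_mem_nhdsWithin] with t ht using h.2 t ht.2

lemma RightLevel.eq_of_continuousAt (h : RightLevel u y α) (hu : IsFuzzyNumber u)
    (hα : 0 ≤ α) (hc : ContinuousAt u y) : u y = α := by
  rw [← neg_neg y, ← leftLevel_comp_neg] at h
  have hc' : ContinuousAt (fun t => u (-t)) (-y) :=
    ContinuousAt.comp (by rwa [neg_neg]) continuous_neg.continuousAt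
  have := h.eq_of_continuousWithinAt hu.comp_neg hα (sub_one_lt _) hc'.continuousWithinAt
  simpa using this

/-- Continuity relative to the support gives a left limit everywhere except at the left end of the
support, where the completed graph may have a vertical segment. The hypothesis `hle` handles that
one point. -/
lemma LeftLevel.eq_of_continuousOn (h : LeftLevel u y α) (hu : IsFuzzyNumber u)
    (hα : α ∈ Icc (0 : ℝ) 1) (hc : ContinuousOn u (cut u 0)) (hle : u (lower u 0) ≤ α) :
    u y = α := by
  have hy := cut_subset_zero hα h.1
  have hy' := (hu.mem_cut_iff IsFuzzyNumber.zero_mem_unit).1 hy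
  rcases hy'.1.eq_or_lt with h0 | h0
  · rw [← h0] at h ⊢
    exact le_antisymm hle (hu.le_of_mem_cut hα.1 h.1)
  · refine h.eq_of_continuousWithinAt hu hα.1 h0 ((hc y hy).mono fun t ht => ?_)
    exact (hu.mem_cut_iff IsFuzzyNumber.zero_mem_unit).2 ⟨ht.1.le, ht.2.le.trans hy'.2⟩

lemma RightLevel.eq_of_continuousOn (h : RightLevel u y α) (hu : IsFuzzyNumber u)
    (hα : α ∈ Icc (0 : ℝ) 1) (hc : ContinuousOn u (cut u 0)) (hle : u (upper u 0) ≤ α) :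
    u y = α := by
  rw [← neg_neg y, ← leftLevel_comp_neg] at h
  have := h.eq_of_continuousOn hu.comp_neg hα
    (hc.comp continuous_neg.continuousOn fun t ht => mem_cut_comp_neg.1 ht)
    (by simpa [lower_comp_neg] using hle)
  simpa using this

/-! ### Monotone selections for a convolution -/

/-- The right end of the increasing branch of `u` at level `α`. -/
noncomputable def leftTop (u : ℝ → ℝ) (α : ℝ) : ℝ := sSup {y | LeftLevel u y α}

lemma IsFuzzyNumber.leftTop_bddAbove (hu : IsFuzzyNumber u) (hα : α ∈ Icc (0 : ℝ) 1) :
    BddAbove {y | LeftLevel u y α} := ⟨_, fun _ hy => LeftLevel.le_upper_one hy hu hα⟩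

lemma IsFuzzyNumber.leftLevel_leftTop (hu : IsFuzzyNumber u) (hα : α ∈ Icc (0 : ℝ) 1) :
    LeftLevel u (leftTop u α) α := by
  have hne : {y | LeftLevel u y α}.Nonempty := ⟨_, hu.leftLevel_lower hα⟩
  have hb := hu.leftTop_bddAbove hα
  constructor
  · rw [hu.mem_cut_iff hα]
    exact ⟨le_csSup hb (hu.leftLevel_lower hα),
      csSup_le hne fun y hy => ((hu.mem_cut_iff hα).1 hy.1).2⟩
  · intro t ht
    obtain ⟨y, hy, hty⟩ := exists_lt_of_lt_csSup hne ht
    exact hy.2 t hty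

lemma IsFuzzyNumber.leftLevel_of_mem (hu : IsFuzzyNumber u) (hα : α ∈ Icc (0 : ℝ) 1)
    (h1 : lower u α ≤ y) (h2 : y ≤ leftTop u α) : LeftLevel u y α := by
  have h := hu.leftLevel_leftTop hα
  refine ⟨(hu.mem_cut_iff hα).2 ⟨h1, h2.trans ((hu.mem_cut_iff hα).1 h.1).2⟩,
    fun t ht => h.2 t (ht.trans_le h2)⟩

lemma IsFuzzyNumber.exists_lt_of_leftTop_lt (hu : IsFuzzyNumber u) (hα : α ∈ Icc (0 : ℝ) 1)
    (hα1 : α < 1) (hy : leftTop u α < y) : ∃ t ≤ y, α < u t := by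
  rcases le_or_gt (upper u 1) y with h | h
  · exact ⟨_, h, by rwa [hu.apply_upper_one]⟩
  · by_contra! hcon
    have : LeftLevel u y α := by
      refine ⟨(hu.mem_cut_iff hα).2 ⟨?_, h.le.trans (hu.one_le_upper hα)⟩, fun t ht => hcon t ht.le⟩
      exact (le_csSup (hu.leftTop_bddAbove hα) (hu.leftLevel_lower hα)).trans hy.le
    exact absurd (le_csSup (hu.leftTop_bddAbove hα) this) hy.not_ge

lemma leftTop_one (hu : IsFuzzyNumber u) : leftTop u 1 = upper u 1 := by
  have h1 : (1 : ℝ) ∈ Icc (0 : ℝ) 1 := IsFuzzyNumber.one_mem_unit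
  refine le_antisymm ((hu.leftLevel_leftTop h1).le_upper_one hu h1) ?_
  exact le_csSup (hu.leftTop_bddAbove h1) ⟨hu.upper_mem h1, fun t _ => hu.le_one t⟩

/-- The point of `u` used by the increasing branch of `conv u v` at `x`: first `u` moves, then
`v`. -/
noncomputable def leftSel (u v : ℝ → ℝ) (x : ℝ) : ℝ :=
  min (leftTop u (conv u v x)) (x - lower v (conv u v x))

lemma leftSel_spec (hu : IsFuzzyNumber u) (hv : IsFuzzyNumber v) (hx0 : x ∈ cut (conv u v) 0)
    (hx1 : x ≤ upper (conv u v) 1) :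
    LeftLevel u (leftSel u v x) (conv u v x) ∧
      LeftLevel v (x - leftSel u v x) (conv u v x) := by
  have hf := hu.conv hv
  rw [leftSel]
  set α := conv u v x with hαdef
  have hα : α ∈ Icc (0 : ℝ) 1 := hf.mem_unit x
  have hxα := hf.mem_cut_self hx0
  rw [← hαdef, cut_conv hu hv hα] at hxα
  have hA : lower u α ≤ leftTop u α := le_csSup (hu.leftTop_bddAbove hα) (hu.leftLevel_lower hα)
  refine ⟨hu.leftLevel_of_mem hα (le_min hA (by linarith [hxα.1])) (min_le_left _ _), ?_⟩
  rcases le_total (leftTop u α) (x - lower v α) with h | h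
  · rw [min_eq_left h]
    -- At level 1 nothing lies beyond the level, but the bound on earlier values is automatic and
    -- only membership in the core has to be checked; this uses `hx1`.
    rcases hα.2.eq_or_lt with h1 | h1
    · rw [h1] at h ⊢
      rw [upper_conv hu hv IsFuzzyNumber.one_mem_unit] at hx1
      refine ⟨(hv.mem_cut_iff IsFuzzyNumber.one_mem_unit).2 ⟨by linarith, ?_⟩,
        fun t _ => hv.le_one t⟩
      rw [leftTop_one hu]
      linarith
    · have key : ∀ t < x - leftTop u α, v t ≤ α := by
        intro t ht
        by_contra! hvt
        obtain ⟨s, hs, hus⟩ := hu.exists_lt_of_leftTop_lt hα h1 (y := x - t) (by linarith)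
        have h2 := (lt_min hus hvt).trans_le (min_le_conv hu v s t)
        exact absurd (hf.apply_le_of_le (by linarith : s + t ≤ x) hx1) h2.not_ge
      refine ⟨(hv.mem_cut_iff hα).2 ⟨by linarith, ?_⟩, key⟩
      refine le_trans ?_ (hv.one_le_upper hα)
      by_contra! hlt
      have := key _ hlt
      rw [hv.apply_upper_one] at this
      linarith
  · rw [min_eq_right h, sub_sub_cancel]
    exact hv.leftLevel_lower hα

lemma leftSel_mono (hu : IsFuzzyNumber u) (hv : IsFuzzyNumber v) (hx0 : x ∈ cut (conv u v) 0)
    (hy0 : y ∈ cut (conv u v) 0) (hxy : x ≤ y) (hy1 : y ≤ upper (conv u v) 1) :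
    leftSel u v x ≤ leftSel u v y ∧ x - leftSel u v x ≤ y - leftSel u v y := by
  have hf := hu.conv hv
  rcases (hf.apply_le_of_le hxy hy1).eq_or_lt with h | h
  · rw [leftSel, leftSel, h]
    refine ⟨min_le_min_left _ (by linarith), ?_⟩
    set a := leftTop u (conv u v y)
    set c := lower v (conv u v y)
    rcases min_cases a (x - c) with h1 | h1 <;> rcases min_cases a (y - c) with h2 | h2 <;>
      rw [h1.1, h2.1] <;> linarith
  · have hx := leftSel_spec hu hv hx0 (hxy.trans hy1)
    have hy := leftSel_spec hu hv hy0 hy1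
    exact ⟨hx.1.le_of_lt hu (hf.nonneg y) hy.1.1 h, hx.2.le_of_lt hv (hf.nonneg y) hy.2.1 h⟩

/-- `Y` and `Z` are monotone decompositions of the identity along which `conv u v` runs through the
completed graphs of `u` and `v`. -/
structure MonotoneSelection (u v Y Z : ℝ → ℝ) : Prop where
  mono_fst : MonotoneOn Y (cut (conv u v) 0)
  mono_snd : MonotoneOn Z (cut (conv u v) 0)
  add_eq : ∀ x, Y x + Z x = x
  left : ∀ x ∈ cut (conv u v) 0, x ≤ upper (conv u v) 1 →
    LeftLevel u (Y x) (conv u v x) ∧ LeftLevel v (Z x) (conv u v x)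
  right : ∀ x ∈ cut (conv u v) 0, lower (conv u v) 1 ≤ x →
    RightLevel u (Y x) (conv u v x) ∧ RightLevel v (Z x) (conv u v x)

/-- The left selection is used up to the right end of the core and the reflected one beyond it. They
glue monotonically because the components of the first stay at or before the right ends of the cores
of `u` and `v`, and those of the second at or after them. -/
theorem exists_monotoneSelection (hu : IsFuzzyNumber u) (hv : IsFuzzyNumber v) :
    ∃ Y Z : ℝ → ℝ, MonotoneSelection u v Y Z := by
  have hf := hu.conv hv
  set f := conv u v with hfdef
  set ur : ℝ → ℝ := fun t => u (-t) with hur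
  set vr : ℝ → ℝ := fun t => v (-t) with hvr
  have hfr : conv ur vr = fun t => f (-t) := conv_comp_neg u v
  have hur' : IsFuzzyNumber ur := hu.comp_neg
  have hvr' : IsFuzzyNumber vr := hv.comp_neg
  have memr : ∀ {x}, x ∈ cut f 0 → -x ∈ cut (conv ur vr) 0 := by
    intro x hx
    rw [hfr, mem_cut_comp_neg, neg_neg]
    exact hx
  have upr : upper (conv ur vr) 1 = -lower f 1 := by rw [hfr, upper_comp_neg]
  have lr : lower f 1 ≤ upper f 1 := hf.lower_le_upper IsFuzzyNumber.one_mem_unit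
  set Y : ℝ → ℝ := fun x => if x ≤ upper f 1 then leftSel u v x else -leftSel ur vr (-x) with hY
  have hYl : ∀ {x}, x ≤ upper f 1 → Y x = leftSel u v x := fun h => if_pos h
  have hYr : ∀ {x}, upper f 1 < x → Y x = -leftSel ur vr (-x) := fun h => if_neg h.not_ge
  have specL : ∀ x ∈ cut f 0, x ≤ upper f 1 →
      LeftLevel u (Y x) (f x) ∧ LeftLevel v (x - Y x) (f x) := by
    intro x hx h
    rw [hYl h]
    exact leftSel_spec hu hv hx h
  have specR : ∀ x ∈ cut f 0, lower f 1 ≤ x →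
      RightLevel u (Y x) (f x) ∧ RightLevel v (x - Y x) (f x) := by
    intro x hx h
    rcases le_or_gt x (upper f 1) with h1 | h1
    · have h2 := specL x hx h1
      -- On the core the level is 1, so the left selection satisfies the right-hand condition as
      -- well.
      rw [hf.apply_eq_one_of_mem h h1] at h2 ⊢
      exact ⟨⟨h2.1.1, fun t _ => hu.le_one t⟩, ⟨h2.2.1, fun t _ => hv.le_one t⟩⟩
    · rw [hYr h1]
      have h2 := leftSel_spec hur' hvr' (memr hx) (by rw [upr]; linarith)
      have h3 : conv ur vr (-x) = f x := by rw [hfr]; simp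
      rw [h3, leftLevel_comp_neg, leftLevel_comp_neg] at h2
      refine ⟨h2.1, ?_⟩
      convert h2.2 using 1
      ring
  have mono : ∀ x ∈ cut f 0, ∀ y ∈ cut f 0, x ≤ y → Y x ≤ Y y ∧ x - Y x ≤ y - Y y := by
    intro x hx y hy hxy
    rcases le_or_gt y (upper f 1) with h | h
    · rw [hYl h, hYl (hxy.trans h)]
      exact leftSel_mono hu hv hx hy hxy h
    · rcases le_or_gt x (upper f 1) with h' | h'
      · have hxL := specL x hx h'
        have hyR := specR y hy (lr.trans h.le)
        have hfy : f y < 1 := by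
          refine lt_of_le_of_ne (hf.le_one y) fun h1 => ?_
          have := hf.mem_cut_self hy
          rw [h1, hf.mem_cut_iff IsFuzzyNumber.one_mem_unit] at this
          linarith
        exact ⟨(hxL.1.le_upper_one hu (hf.mem_unit x)).trans (hyR.1.upper_one_le hu hfy),
          (hxL.2.le_upper_one hv (hf.mem_unit x)).trans (hyR.2.upper_one_le hv hfy)⟩
      · rw [hYr h, hYr h']
        have := leftSel_mono hur' hvr' (memr hy) (memr hx) (neg_le_neg hxy)
          (by rw [upr]; linarith)
        constructor <;> linarith
  exact ⟨Y, fun x => x - Y x, fun x hx y hy h => (mono x hx y hy h).1,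
    fun x hx y hy h => (mono x hx y hy h).2, fun x => by ring, specL, specR⟩

/-! ### Consequences of a monotone selection -/

/-- The endpoint condition makes `conv u v` at least `v (lower v 0)` at the left end of its support,
and the increasing branch does not fall below that. This supplies the hypothesis of
`LeftLevel.eq_of_continuousOn`. -/
lemma endpoint_le_conv_left (hu : IsFuzzyNumber u) (hv : IsFuzzyNumber v)
    (h : v (lower v 0) ≤ u (lower u 0)) (hx0 : x ∈ cut (conv u v) 0)
    (hx1 : x ≤ upper (conv u v) 1) : v (lower v 0) ≤ conv u v x := by
  have hf := hu.conv hv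
  have h1 := min_le_conv hu v (lower u 0) (lower v 0)
  rw [min_eq_right h, ← lower_conv hu hv IsFuzzyNumber.zero_mem_unit] at h1
  exact h1.trans (hf.apply_le_of_le ((hf.mem_cut_iff IsFuzzyNumber.zero_mem_unit).1 hx0).1 hx1)

/-- In a decomposition of the left endpoint other than the one into both left endpoints, one summand
lies outside its support and has value 0. -/
lemma conv_lower_le (hu : IsFuzzyNumber u) (hv : IsFuzzyNumber v) :
    conv u v (lower (conv u v) 0) ≤ v (lower v 0) := by
  refine conv_le fun y z hyz => ?_
  rw [lower_conv hu hv IsFuzzyNumber.zero_mem_unit] at hyz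
  rcases lt_trichotomy y (lower u 0) with h | h | h
  · exact (min_le_left _ _).trans ((hu.eq_zero_of_lt_lower h).le.trans (hv.nonneg _))
  · obtain rfl : z = lower v 0 := by linarith
    exact min_le_right _ _
  · have : z < lower v 0 := by linarith
    exact (min_le_right _ _).trans ((hv.eq_zero_of_lt_lower this).le.trans (hv.nonneg _))

lemma endpoint_le_conv_right (hu : IsFuzzyNumber u) (hv : IsFuzzyNumber v)
    (h : v (upper v 0) ≤ u (upper u 0)) (hx0 : x ∈ cut (conv u v) 0)
    (hx1 : lower (conv u v) 1 ≤ x) : v (upper v 0) ≤ conv u v x := by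
  have := endpoint_le_conv_left (x := -x) hu.comp_neg hv.comp_neg
    (by simpa [lower_comp_neg] using h)
    (by rw [conv_comp_neg, mem_cut_comp_neg, neg_neg]; exact hx0)
    (by rw [conv_comp_neg, upper_comp_neg]; exact neg_le_neg hx1)
  rw [conv_comp_neg] at this
  simpa [lower_comp_neg] using this

lemma conv_upper_le (hu : IsFuzzyNumber u) (hv : IsFuzzyNumber v) :
    conv u v (upper (conv u v) 0) ≤ v (upper v 0) := by
  have := conv_lower_le hu.comp_neg hv.comp_neg
  rw [conv_comp_neg] at this
  simpa [lower_comp_neg] using this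

namespace MonotoneSelection

variable {Y Z : ℝ → ℝ}

lemma mem_cut (h : MonotoneSelection u v Y Z) (hu : IsFuzzyNumber u) (hv : IsFuzzyNumber v)
    (hx : x ∈ cut (conv u v) 0) : Y x ∈ cut u 0 ∧ Z x ∈ cut v 0 := by
  have hf := hu.conv hv
  rcases le_total x (upper (conv u v) 1) with h1 | h1
  · have := h.left x hx h1
    exact ⟨cut_subset_zero (hf.mem_unit x) this.1.1, cut_subset_zero (hf.mem_unit x) this.2.1⟩
  · have := h.right x hx ((hf.lower_le_upper IsFuzzyNumber.one_mem_unit).trans h1)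
    exact ⟨cut_subset_zero (hf.mem_unit x) this.1.1, cut_subset_zero (hf.mem_unit x) this.2.1⟩

lemma abs_sub_le (h : MonotoneSelection u v Y Z) (hx : x ∈ cut (conv u v) 0)
    (hy : y ∈ cut (conv u v) 0) : |Y x - Y y| ≤ |x - y| ∧ |Z x - Z y| ≤ |x - y| := by
  have h1 := h.add_eq x
  have h2 := h.add_eq y
  rcases le_total x y with hxy | hxy
  · have h3 := h.mono_fst hx hy hxy
    have h4 := h.mono_snd hx hy hxy
    rw [abs_of_nonpos (sub_nonpos.2 h3), abs_of_nonpos (sub_nonpos.2 h4),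
      abs_of_nonpos (sub_nonpos.2 hxy)]
    constructor <;> linarith
  · have h3 := h.mono_fst hy hx hxy
    have h4 := h.mono_snd hy hx hxy
    rw [abs_of_nonneg (sub_nonneg.2 h3), abs_of_nonneg (sub_nonneg.2 h4),
      abs_of_nonneg (sub_nonneg.2 hxy)]
    constructor <;> linarith

lemma continuousOn_snd (h : MonotoneSelection u v Y Z) : ContinuousOn Z (cut (conv u v) 0) := by
  refine LipschitzOnWith.continuousOn (K := 1) (LipschitzOnWith.of_dist_le_mul fun a ha b hb => ?_)
  rw [NNReal.coe_one, one_mul, Real.dist_eq, Real.dist_eq]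
  exact (h.abs_sub_le ha hb).2

lemma conv_eq_snd (h : MonotoneSelection u v Y Z) (hu : IsFuzzyNumber u) (hv : IsFuzzyNumber v)
    (hc : ContinuousOn v (cut v 0)) (he : EndpointLE v u) (hx : x ∈ cut (conv u v) 0) :
    conv u v x = v (Z x) := by
  have hf := hu.conv hv
  rcases le_total x (upper (conv u v) 1) with h1 | h1
  · exact ((h.left x hx h1).2.eq_of_continuousOn hv (hf.mem_unit x) hc
      (endpoint_le_conv_left hu hv he.1 hx h1)).symm
  · have h2 := (hf.lower_le_upper IsFuzzyNumber.one_mem_unit).trans h1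
    exact ((h.right x hx h2).2.eq_of_continuousOn hv (hf.mem_unit x) hc
      (endpoint_le_conv_right hu hv he.2 hx h2)).symm

end MonotoneSelection

lemma continuousOn_conv (hu : IsFuzzyNumber u) (hv : IsFuzzyNumber v)
    (hc : ContinuousOn v (cut v 0)) (he : EndpointLE v u) :
    ContinuousOn (conv u v) (cut (conv u v) 0) := by
  obtain ⟨Y, Z, h⟩ := exists_monotoneSelection hu hv
  exact (hc.comp h.continuousOn_snd fun x hx => (h.mem_cut hu hv hx).2).congr
    fun x hx => h.conv_eq_snd hu hv hc he hx

lemma IsFuzzyNumber.cut_zero_mem_nhds (hu : IsFuzzyNumber u)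
    (hx : x ∈ Ioo (lower u 0) (upper u 0)) : cut u 0 ∈ 𝓝 x := by
  rw [(hu.cut_eq IsFuzzyNumber.zero_mem_unit).2]
  exact Icc_mem_nhds hx.1 hx.2

/-! ### Differentiability along a decomposition of the variable -/

section Calculus

open Asymptotics

variable {f g W Y Z : ℝ → ℝ}

/-- A chain rule for an inner function that is only Lipschitz at the point: the first-order change
of `f` is `b` times the increment of `Z`, whether or not that increment is itself linear. -/
lemma isLittleO_of_eq_comp {b : ℝ} (hZ : (fun t => Z t - Z x) =O[𝓝 x] fun t => t - x)
    (hv : HasDerivAt v b (Z x)) (hf : f =ᶠ[𝓝 x] fun t => v (Z t)) :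
    (fun t => f t - f x - (Z t - Z x) * b) =o[𝓝 x] fun t => t - x := by
  have hcont : Tendsto Z (𝓝 x) (𝓝 (Z x)) := by
    have h0 : Tendsto (fun t : ℝ => t - x) (𝓝 x) (𝓝 0) := by
      have : ContinuousAt (fun t : ℝ => t - x) x := by fun_prop
      simpa [ContinuousAt] using this
    have := (hZ.trans_tendsto h0).add_const (Z x)
    simpa using this
  refine (((hasDerivAt_iff_isLittleO.1 hv).comp_tendsto hcont).trans_isBigO hZ).congr' ?_
    (Eventually.of_forall fun _ => rfl)
  filter_upwards [hf] with t ht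
  simp only [Function.comp_apply, smul_eq_mul, ht, hf.eq_of_nhds]

lemma hasDerivAt_zero_of_eq_comp (hZ : (fun t => Z t - Z x) =O[𝓝 x] fun t => t - x)
    (hv : HasDerivAt v 0 (Z x)) (hf : f =ᶠ[𝓝 x] fun t => v (Z t)) : HasDerivAt f 0 x := by
  rw [hasDerivAt_iff_isLittleO]
  simpa using isLittleO_of_eq_comp hZ hv hf

/-- If `f` is a reparametrization of two differentiable functions, by parameters of which a linear
combination is the variable, then `f` is differentiable. -/
lemma differentiableAt_of_eq_comp {b d c : ℝ}
    (hZ : (fun t => Z t - Z x) =O[𝓝 x] fun t => t - x)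
    (hW : (fun t => W t - W x) =O[𝓝 x] fun t => t - x)
    (hsplit : ∀ᶠ t in 𝓝 x, t - x = c * (Z t - Z x) + (W t - W x))
    (hv : HasDerivAt v b (Z x)) (hg : HasDerivAt g d (W x))
    (hfv : f =ᶠ[𝓝 x] fun t => v (Z t)) (hfg : f =ᶠ[𝓝 x] fun t => g (W t)) :
    DifferentiableAt ℝ f x := by
  rcases eq_or_ne b 0 with rfl | hb
  · exact (hasDerivAt_zero_of_eq_comp hZ hv hfv).differentiableAt
  rcases eq_or_ne d 0 with rfl | hd
  · exact (hasDerivAt_zero_of_eq_comp hW hg hfg).differentiableAt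
  -- Solving for the increments of `Z` and `W` in terms of that of `f` turns `hsplit` into `t - x =
  -- κ * (f t - f x)` up to a small error.
  set κ := c / b + 1 / d with hκ
  have hlin : (fun t => (t - x) - κ * (f t - f x)) =o[𝓝 x] fun t => t - x := by
    have h1 := (isLittleO_of_eq_comp hZ hv hfv).const_mul_left (-(c / b))
    have h2 := (isLittleO_of_eq_comp hW hg hfg).const_mul_left (-(1 / d))
    refine (h1.add h2).congr' ?_ (Eventually.of_forall fun _ => rfl)
    filter_upwards [hsplit] with t ht
    rw [ht, hκ]
    field_simp
    ring
  -- If `κ` vanished, `t - x` would be negligible against itself. No sign condition on `b`, `c`, `d`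
  -- is needed.
  have hκ0 : κ ≠ 0 := by
    intro h0
    simp only [h0, zero_mul, sub_zero] at hlin
    refine isLittleO_irrefl ?_ hlin
    have h1 : ∃ᶠ t in 𝓝[≠] x, t - x ≠ 0 := by
      refine Eventually.frequently ?_
      filter_upwards [self_mem_nhdsWithin] with t ht using sub_ne_zero.2 ht
    exact h1.filter_mono nhdsWithin_le_nhds
  refine HasDerivAt.differentiableAt (f' := κ⁻¹) ?_
  rw [hasDerivAt_iff_isLittleO]
  refine (hlin.const_mul_left (-κ⁻¹)).congr' (Eventually.of_forall fun t => ?_)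
    (Eventually.of_forall fun _ => rfl)
  simp only [smul_eq_mul]
  field_simp
  ring

lemma eq_zero_of_hasDerivAt_of_eventually_eq {d : ℝ} {l : Filter ℝ} [l.NeBot]
    (hg : HasDerivAt g d x) (hl : l ≤ 𝓝[≠] x) (h : ∀ᶠ t in l, g t = g x) : d = 0 := by
  refine tendsto_nhds_unique ((hasDerivAt_iff_tendsto_slope.1 hg).mono_left hl)
    (tendsto_const_nhds.congr' ?_)
  filter_upwards [h] with t ht
  rw [slope_def_field, ht, sub_self, zero_div]

end Calculus

/-! ### Rescaling a smoother -/

section Scale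

variable {ζ Y Z : ℝ → ℝ} {p : ℝ}

lemma LeftLevel.of_scale (hp : 0 < p) (h : LeftLevel (scale p v) z α) :
    LeftLevel v (z / p) α := by
  refine ⟨(mem_cut_scale hp).1 h.1, fun t ht => ?_⟩
  have := h.2 (t * p) ((lt_div_iff₀ hp).1 ht)
  rwa [scale_apply hp, mul_div_cancel_right₀ _ hp.ne'] at this

lemma RightLevel.of_scale (hp : 0 < p) (h : RightLevel (scale p v) z α) :
    RightLevel v (z / p) α := by
  refine ⟨(mem_cut_scale hp).1 h.1, fun t ht => ?_⟩
  have := h.2 (t * p) ((div_lt_iff₀ hp).1 ht)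
  rwa [scale_apply hp, mul_div_cancel_right₀ _ hp.ne'] at this

/-- Along a monotone selection the values of `conv u (scale p ζ)` are values of `conv u ζ`. -/
lemma MonotoneSelection.conv_scale_eq (h : MonotoneSelection u (scale p ζ) Y Z) (hp : 0 < p)
    (hu : IsFuzzyNumber u) (hζ : IsFuzzyNumber ζ)
    (hc : ContinuousOn (Fuzzy.conv u ζ) (cut (Fuzzy.conv u ζ) 0))
    (he : EndpointLE ζ u) (hx : x ∈ cut (Fuzzy.conv u (scale p ζ)) 0) :
    Fuzzy.conv u (scale p ζ) x = Fuzzy.conv u ζ (Y x + Z x / p) := by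
  have hv := hζ.scale hp
  have hf := hu.conv hv
  have hg := hu.conv hζ
  have he' := he.scale hζ hp
  have hα := hf.mem_unit x
  rcases le_total x (upper (Fuzzy.conv u (scale p ζ)) 1) with h1 | h1
  · have h2 := h.left x hx h1
    refine ((h2.1.conv (h2.2.of_scale hp) hu hζ hα).eq_of_continuousOn hg hα hc
      ((conv_lower_le hu hζ).trans ?_)).symm
    have := endpoint_le_conv_left hu hv he'.1 hx h1
    rwa [scale_apply hp, lower_scale hp hζ IsFuzzyNumber.zero_mem_unit,
      mul_div_cancel_left₀ _ hp.ne'] at this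
  · have h1' := (hf.lower_le_upper IsFuzzyNumber.one_mem_unit).trans h1
    have h2 := h.right x hx h1'
    refine ((h2.1.conv (h2.2.of_scale hp) hu hζ hα).eq_of_continuousOn hg hα hc
      ((conv_upper_le hu hζ).trans ?_)).symm
    have := endpoint_le_conv_right hu hv he'.2 hx h1'
    rwa [scale_apply hp, upper_scale hp hζ IsFuzzyNumber.zero_mem_unit,
      mul_div_cancel_left₀ _ hp.ne'] at this

open Asymptotics in
lemma MonotoneSelection.isBigO (h : MonotoneSelection u v Y Z)
    (hx : cut (Fuzzy.conv u v) 0 ∈ 𝓝 x) :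
    (fun t => Y t - Y x) =O[𝓝 x] (fun t => t - x) ∧
      (fun t => Z t - Z x) =O[𝓝 x] (fun t => t - x) := by
  constructor <;> refine IsBigO.of_bound 1 ?_ <;> filter_upwards [hx] with t ht <;>
    rw [one_mul, Real.norm_eq_abs, Real.norm_eq_abs]
  · exact (h.abs_sub_le ht (mem_of_mem_nhds hx)).1
  · exact (h.abs_sub_le ht (mem_of_mem_nhds hx)).2

/-- Rescalings of a smoother with small endpoint values are smoothers. -/
theorem IsSmoother.scale (hu : IsFuzzyNumber u) (hζ : IsSmoother u ζ) (he : EndpointLE ζ u)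
    (hp : 0 < p) : IsSmoother u (scale p ζ) := by
  obtain ⟨hζs, hgs⟩ := hζ
  have hζf := hζs.isFuzzyNumber
  have hvs := hζs.scale hp
  have hv := hvs.isFuzzyNumber
  have hf := hu.conv hv
  have he' := he.scale hζf hp
  refine ⟨hvs, hf, continuousOn_conv hu hv hvs.continuousOn he', fun x hx => ?_⟩
  obtain ⟨Y, Z, h⟩ := exists_monotoneSelection hu hv
  have hS := hf.cut_zero_mem_nhds hx
  have hxS := mem_of_mem_nhds hS
  set W : ℝ → ℝ := fun t => Y t + Z t / p with hW
  have hfv : Fuzzy.conv u (Fuzzy.scale p ζ) =ᶠ[𝓝 x] fun t => Fuzzy.scale p ζ (Z t) := by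
    filter_upwards [hS] with t ht using h.conv_eq_snd hu hv hvs.continuousOn he' ht
  have hfg : Fuzzy.conv u (Fuzzy.scale p ζ) =ᶠ[𝓝 x] fun t => Fuzzy.conv u ζ (W t) := by
    filter_upwards [hS] with t ht using h.conv_scale_eq hp hu hζf hgs.continuousOn he ht
  obtain ⟨hYO, hZO⟩ := h.isBigO hS
  have hWO : (fun t => W t - W x) =O[𝓝 x] fun t => t - x := by
    refine (hYO.add (hZO.const_mul_left p⁻¹)).congr_left fun t => ?_
    simp only [hW]
    ring
  have h0 := IsFuzzyNumber.zero_mem_unit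
  have hmem := h.mem_cut hu hv hxS
  have hY := (hu.mem_cut_iff h0).1 hmem.1
  have hZ := (hv.mem_cut_iff h0).1 hmem.2
  -- `W x` could be an end of its interval only if `Y x` and `Z x / p` were both ends on the same
  -- side, and then `x = Y x + Z x` would be an end as well.
  have hWmem : W x ∈ Ioo (lower (Fuzzy.conv u ζ) 0) (upper (Fuzzy.conv u ζ) 0) := by
    have hx' := hx
    rw [lower_conv hu hv h0, upper_conv hu hv h0, ← h.add_eq x] at hx'
    have hl := lower_scale hp hζf h0
    have hr := upper_scale hp hζf h0
    rw [lower_conv hu hζf h0, upper_conv hu hζf h0]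
    constructor
    · have h1 : lower ζ 0 ≤ Z x / p := by rw [le_div_iff₀' hp, ← hl]; exact hZ.1
      rcases hY.1.lt_or_eq with h2 | h2
      · exact add_lt_add_of_lt_of_le h2 h1
      · refine add_lt_add_of_le_of_lt hY.1 ?_
        rw [lt_div_iff₀' hp, ← hl]
        linarith [hx'.1]
    · have h1 : Z x / p ≤ upper ζ 0 := by rw [div_le_iff₀' hp, ← hr]; exact hZ.2
      rcases hY.2.lt_or_eq with h2 | h2
      · exact add_lt_add_of_lt_of_le h2 h1
      · refine add_lt_add_of_le_of_lt hY.2 ?_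
        rw [div_lt_iff₀' hp, ← hr]
        linarith [hx'.2]
  have hg := (hgs.differentiableAt _ hWmem).hasDerivAt
  set d := deriv (Fuzzy.conv u ζ) (W x)
  -- Where `Z` stands still, `Y` and hence `W` move at unit speed while `f` keeps its value, so
  -- `conv u ζ` is constant along the corresponding segment.
  have hconst : ∀ t ∈ cut (Fuzzy.conv u (Fuzzy.scale p ζ)) 0, Z t = Z x →
      Fuzzy.conv u ζ (W x + (t - x)) = Fuzzy.conv u ζ (W x) := by
    intro t ht hZt
    have h1 := h.conv_scale_eq hp hu hζf hgs.continuousOn he ht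
    have h2 := h.conv_scale_eq hp hu hζf hgs.continuousOn he hxS
    have h3 := h.conv_eq_snd hu hv hvs.continuousOn he' ht
    have h4 := h.conv_eq_snd hu hv hvs.continuousOn he' hxS
    have h5 : W x + (t - x) = Y t + Z t / p := by
      simp only [hW]
      rw [hZt]
      linarith [h.add_eq t, h.add_eq x]
    rw [h5, ← h1, h3, hZt, ← h4, h2]
  have hdz : d = 0 → DifferentiableAt ℝ (Fuzzy.conv u (Fuzzy.scale p ζ)) x := by
    intro hd
    rw [hd] at hg
    exact (hasDerivAt_zero_of_eq_comp hWO hg hfg).differentiableAt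
  -- At an end of its support `scale p ζ` need not be differentiable. But there monotonicity freezes
  -- `Z` on one side of `x`, so `hconst` gives `d = 0`, and `f = conv u ζ ∘ W` alone yields
  -- derivative 0.
  rcases hZ.1.eq_or_lt with hl | hl
  · refine hdz (eq_zero_of_hasDerivAt_of_eventually_eq (l := 𝓝[<] (W x)) hg
      (nhdsWithin_mono _ fun t (ht : t < _) => ht.ne) ?_)
    have : Ioo (W x - (x - lower (Fuzzy.conv u (Fuzzy.scale p ζ)) 0)) (W x) ∈ 𝓝[<] (W x) :=
      Ioo_mem_nhdsLT (by linarith [hx.1])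
    filter_upwards [this] with w hw
    have ht : x + (w - W x) ∈ cut (Fuzzy.conv u (Fuzzy.scale p ζ)) 0 :=
      (hf.mem_cut_iff h0).2 ⟨by linarith [hw.1], by linarith [hw.2, hx.2]⟩
    have hle := h.mono_snd ht hxS (by linarith [hw.2])
    have hge := ((hv.mem_cut_iff h0).1 (h.mem_cut hu hv ht).2).1
    have := hconst _ ht (le_antisymm hle (hl ▸ hge))
    rwa [add_sub_cancel_left, add_sub_cancel] at this
  rcases hZ.2.eq_or_lt with hr | hr
  · refine hdz (eq_zero_of_hasDerivAt_of_eventually_eq (l := 𝓝[>] (W x)) hg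
      (nhdsWithin_mono _ fun t (ht : _ < t) => ht.ne') ?_)
    have : Ioo (W x) (W x + (upper (Fuzzy.conv u (Fuzzy.scale p ζ)) 0 - x)) ∈ 𝓝[>] (W x) :=
      Ioo_mem_nhdsGT (by linarith [hx.2])
    filter_upwards [this] with w hw
    have ht : x + (w - W x) ∈ cut (Fuzzy.conv u (Fuzzy.scale p ζ)) 0 :=
      (hf.mem_cut_iff h0).2 ⟨by linarith [hw.1, hx.1], by linarith [hw.2]⟩
    have hge := h.mono_snd hxS ht (by linarith [hw.1])
    have hle := ((hv.mem_cut_iff h0).1 (h.mem_cut hu hv ht).2).2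
    have := hconst _ ht (le_antisymm (hr ▸ hle) hge)
    rwa [add_sub_cancel_left, add_sub_cancel] at this
  refine differentiableAt_of_eq_comp (c := 1 - p⁻¹) hZO hWO ?_
    (hvs.differentiableAt _ ⟨hl, hr⟩).hasDerivAt hg hfv hfg
  refine Eventually.of_forall fun t => ?_
  have h1 := h.add_eq t
  have h2 := h.add_eq x
  simp only [hW]
  linear_combination -h1 + h2

end Scale

/-! ### A smoother with prescribed critical values -/

lemma surjective_const_add_cube (b : ℝ) : Function.Surjective fun x : ℝ => b + x ^ 3 := by
  intro y
  obtain ⟨x, hx⟩ : ∃ x : ℝ, x ^ 3 = y - b := by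
    rcases le_total 0 (y - b) with h | h
    · exact ⟨(y - b) ^ ((3 : ℕ) : ℝ)⁻¹, Real.rpow_inv_natCast_pow h (by norm_num)⟩
    · refine ⟨-(-(y - b)) ^ ((3 : ℕ) : ℝ)⁻¹, ?_⟩
      rw [Odd.neg_pow (by decide), Real.rpow_inv_natCast_pow (by linarith) (by norm_num), neg_neg]
  exact ⟨x, by dsimp only; linarith⟩

/-- There are increasing differentiable bijections of `ℝ` with prescribed critical values. -/
lemma exists_strictMono_hasDerivAt_zero (P : Finset ℝ) :
    ∃ φ : ℝ → ℝ, StrictMono φ ∧ Differentiable ℝ φ ∧ Function.Surjective φ ∧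
      ∀ x, φ x ∈ P → HasDerivAt φ 0 x := by
  induction P using Finset.induction_on with
  | empty => exact ⟨id, strictMono_id, differentiable_id, Function.surjective_id, by simp⟩
  | insert a P _ ih =>
    obtain ⟨φ, hm, hd, hs, h0⟩ := ih
    obtain ⟨b, rfl⟩ := hs a
    have hτ : ∀ x : ℝ, HasDerivAt (fun x : ℝ => b + x ^ 3) (3 * x ^ 2) x := by
      intro x
      simpa using (hasDerivAt_pow 3 x).const_add b
    -- Precomposing with a cubic makes the preimage of the new value `a = φ b` critical, and the
    -- chain rule keeps the old critical values.
    refine ⟨fun x => φ (b + x ^ 3), fun x y hxy => hm ?_, fun x => ?_,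
      hs.comp (surjective_const_add_cube b), fun x hx => ?_⟩
    · have : x ^ 3 < y ^ 3 := (Odd.strictMono_pow (by decide)) hxy
      linarith
    · exact (hd _).comp x (hτ x).differentiableAt
    · rcases Finset.mem_insert.1 hx with h | h
      · have hx0 : x ^ 3 = 0 := by
          have := hm.injective h
          linarith
        have := (hd (b + x ^ 3)).hasDerivAt.comp x (hτ x)
        rw [pow_eq_zero_iff (by norm_num)] at hx0
        simpa [hx0, Function.comp_def] using this
      · have := (h0 _ h).comp x (hτ x)
        simpa [Function.comp_def] using this

/-- The function is `φ (c - |t|)` cut off at 0, where `φ` takes the values 0 at `b` and 1 at `c`.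
Adding 1 to the critical values of `φ` removes the kink of `|t|` at the peak. -/
lemma exists_isSmooth_hasDerivAt_zero (P : Finset ℝ) :
    ∃ ζ : ℝ → ℝ, IsSmooth ζ ∧ ζ (lower ζ 0) = 0 ∧ ζ (upper ζ 0) = 0 ∧
      ∀ x ∈ Ioo (lower ζ 0) (upper ζ 0), ζ x ∈ P → HasDerivAt ζ 0 x := by
  obtain ⟨φ, hm, hd, hs, h0⟩ := exists_strictMono_hasDerivAt_zero (insert 1 P)
  obtain ⟨b, hb⟩ := hs 0
  obtain ⟨c, hc⟩ := hs 1
  have hbc : b < c := hm.lt_iff_lt.1 (by rw [hb, hc]; exact zero_lt_one)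
  set ζ : ℝ → ℝ := fun t => max 0 (φ (c - |t|)) with hζ
  have hpos : ∀ t, 0 < ζ t ↔ |t| < c - b := by
    intro t
    have : 0 < φ (c - |t|) ↔ |t| < c - b := by
      rw [← hb, hm.lt_iff_lt, lt_sub_comm]
    simp [hζ, this]
  have hcut0 : cut ζ 0 = Icc (-(c - b)) (c - b) := by
    have : {t | 0 < ζ t} = Ioo (-(c - b)) (c - b) := by
      ext t
      rw [mem_ofPred_eq, hpos, abs_lt, mem_Ioo]
    rw [cut, if_pos rfl, this, closure_Ioo]
    intro h
    linarith
  have hlower : lower ζ 0 = -(c - b) := by rw [lower, hcut0, csInf_Icc (by linarith)]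
  have hupper : upper ζ 0 = c - b := by rw [upper, hcut0, csSup_Icc (by linarith)]
  have hfuz : IsFuzzyNumber ζ := by
    refine ⟨fun t => ⟨le_max_left _ _, max_le zero_le_one ?_⟩, ⟨0, ?_⟩, fun α hα => ?_⟩
    · rw [← hc]
      exact hm.monotone (by linarith [abs_nonneg t])
    · rw [mem_cut_of_pos zero_lt_one]
      simp [hζ, hc]
    · rcases hα.1.eq_or_lt with rfl | hα0
      · exact ⟨_, _, hcut0⟩
      · obtain ⟨a, rfl⟩ := hs α
        refine ⟨-(c - a), c - a, ?_⟩
        ext t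
        rw [mem_cut_of_pos hα0, mem_Icc, ← abs_le, hζ]
        dsimp only
        rw [le_max_iff, hm.le_iff_le]
        constructor
        · rintro (h | h) <;> linarith
        · intro h
          right
          linarith
  have heq : ∀ t ∈ Ioo (lower ζ 0) (upper ζ 0), ζ =ᶠ[𝓝 t] fun s => φ (c - |s|) := by
    intro t ht
    filter_upwards [isOpen_Ioo.mem_nhds ht] with s hs
    rw [hlower, hupper, mem_Ioo, ← abs_lt, ← hpos] at hs
    rcases le_or_gt (φ (c - |s|)) 0 with h | h
    · exact absurd hs (by rw [hζ]; simp [h])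
    · exact max_eq_right h.le
  have hcrit : ∀ t ∈ Ioo (lower ζ 0) (upper ζ 0), ζ t ∈ insert 1 P → HasDerivAt ζ 0 t := by
    intro t ht htP
    rw [(heq t ht).eq_of_nhds] at htP
    -- The inner map `s ↦ c - |s|` is 1-Lipschitz, which suffices at a critical value, even at `t =
    -- 0`.
    refine hasDerivAt_zero_of_eq_comp (Asymptotics.IsBigO.of_bound 1 ?_) (h0 _ htP) (heq t ht)
    refine Eventually.of_forall fun s => ?_
    rw [sub_sub_sub_cancel_left, one_mul, Real.norm_eq_abs, Real.norm_eq_abs, abs_sub_comm s]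
    exact abs_abs_sub_abs_le t s
  refine ⟨ζ, ⟨hfuz, ?_, fun t ht => ?_⟩, ?_, ?_, fun t ht h => hcrit t ht (by simp [h])⟩
  · have := hd.continuous
    exact Continuous.continuousOn (by fun_prop)
  · rcases eq_or_ne t 0 with rfl | ht0
    · exact (hcrit 0 ht (by simp [hζ, hc])).differentiableAt
    · refine DifferentiableAt.congr_of_eventuallyEq ?_ (heq t ht)
      exact (hd _).comp t ((differentiableAt_const c).sub (differentiableAt_abs ht0))
  · rw [hlower, hζ]
    dsimp only
    rw [abs_neg, abs_of_pos (sub_pos.2 hbc), sub_sub_cancel, hb, max_self]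
  · rw [hupper, hζ]
    simp [abs_of_pos (sub_pos.2 hbc), hb]

/-! ### Existence of smoothers -/

/-- The levels of `u` at `y`: the value and the suprema to both sides, which on a branch of a fuzzy
number are one-sided limits. -/
noncomputable def jumpLevels (u : ℝ → ℝ) (y : ℝ) : Set ℝ :=
  {u y, sSup (u '' Iio y), sSup (u '' Ioi y)}

/-- A branch stands still while it crosses a jump. -/
lemma LeftLevel.eventually_eq (h : LeftLevel u y α) (hu : IsFuzzyNumber u) (hα : 0 ≤ α)
    (hy : α ∉ jumpLevels u y) : ∀ᶠ β in 𝓝 α, 0 ≤ β → ∀ z, LeftLevel u z β → z = y := by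
  simp only [jumpLevels, mem_insert_iff, mem_singleton_iff, not_or] at hy
  have h1 : α < u y := lt_of_le_of_ne (hu.le_of_mem_cut hα h.1) hy.1
  have h2 : sSup (u '' Iio y) < α := by
    refine lt_of_le_of_ne (csSup_le (nonempty_Iio.image u) ?_) (Ne.symm hy.2.1)
    rintro _ ⟨t, ht, rfl⟩
    exact h.2 t ht
  filter_upwards [Ioo_mem_nhds h2 h1] with β hβ hβ0 z hz
  rcases lt_trichotomy z y with hlt | heq | hgt
  · have h3 : u z ≤ sSup (u '' Iio y) := by
      refine le_csSup ⟨1, ?_⟩ ⟨z, hlt, rfl⟩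
      rintro _ ⟨t, _, rfl⟩
      exact hu.le_one t
    have h4 := hu.le_of_mem_cut hβ0 hz.1
    linarith [hβ.1]
  · exact heq
  · exact absurd (hz.2 y hgt) hβ.2.not_ge

lemma RightLevel.eventually_eq (h : RightLevel u y α) (hu : IsFuzzyNumber u) (hα : 0 ≤ α)
    (hy : α ∉ jumpLevels u y) : ∀ᶠ β in 𝓝 α, 0 ≤ β → ∀ z, RightLevel u z β → z = y := by
  rw [← neg_neg y, ← leftLevel_comp_neg] at h
  have himg : ∀ s : Set ℝ, (fun t => u (-t)) '' s = u '' (-s) := by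
    intro s
    rw [← Set.image_neg_eq_neg, Set.image_image]
  have := h.eventually_eq hu.comp_neg hα (by
    simp only [jumpLevels, himg, neg_neg, Set.neg_Iio, Set.neg_Ioi] at hy ⊢
    rw [mem_insert_iff, mem_insert_iff, mem_singleton_iff] at hy ⊢
    tauto)
  filter_upwards [this] with β hβ hβ0 z hz
  rw [← neg_neg z, ← leftLevel_comp_neg] at hz
  exact neg_injective (hβ hβ0 _ hz)

/-- A fuzzy number with finitely many points of non-differentiability has a smoother which vanishes
at the endpoints of its support. -/
theorem exists_isSmoother (hu : IsFuzzyNumber u)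
    (hfin : {x : ℝ | ¬ DifferentiableAt ℝ u x}.Finite) :
    ∃ ζ : ℝ → ℝ, IsSmoother u ζ ∧ EndpointLE ζ u := by
  -- The exceptional levels: 1, so that every other level lies strictly on one branch, and the ends
  -- of the vertical segments of `u` over its bad points.
  have hP : (insert 1 (⋃ y ∈ {x : ℝ | ¬ DifferentiableAt ℝ u x}, jumpLevels u y)).Finite :=
    (hfin.biUnion fun y _ => by rw [jumpLevels]; exact Set.toFinite _).insert 1
  obtain ⟨ζ, hζ, hl0, hr0, hcrit⟩ := exists_isSmooth_hasDerivAt_zero hP.toFinset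
  have hv := hζ.isFuzzyNumber
  have hf := hu.conv hv
  have he : EndpointLE ζ u := by
    rw [EndpointLE, hl0, hr0]
    exact ⟨hu.nonneg _, hu.nonneg _⟩
  have hcont := continuousOn_conv hu hv hζ.continuousOn he
  refine ⟨ζ, ⟨hζ, hf, hcont, fun x hx => ?_⟩, he⟩
  obtain ⟨Y, Z, h⟩ := exists_monotoneSelection hu hv
  have hS := hf.cut_zero_mem_nhds hx
  have hxS := mem_of_mem_nhds hS
  have hfv : Fuzzy.conv u ζ =ᶠ[𝓝 x] fun t => ζ (Z t) := by
    filter_upwards [hS] with t ht using h.conv_eq_snd hu hv hζ.continuousOn he ht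
  obtain ⟨hYO, hZO⟩ := h.isBigO hS
  have hα := hf.mem_unit x
  have hpos := hf.pos_of_mem_Ioo hx
  have hZx : Z x ∈ Ioo (lower ζ 0) (upper ζ 0) := by
    have h1 := (hv.mem_cut_iff IsFuzzyNumber.zero_mem_unit).1 (h.mem_cut hu hv hxS).2
    rw [hfv.eq_of_nhds] at hpos
    refine ⟨lt_of_le_of_ne h1.1 fun h2 => ?_, lt_of_le_of_ne h1.2 fun h2 => ?_⟩
    · rw [← h2, hl0] at hpos
      exact hpos.ne rfl
    · rw [h2, hr0] at hpos
      exact hpos.ne rfl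
  by_cases hxP : Fuzzy.conv u ζ x ∈ hP.toFinset
  · have := hcrit _ hZx (by rwa [← hfv.eq_of_nhds])
    exact (hasDerivAt_zero_of_eq_comp hZO this hfv).differentiableAt
  rw [Set.Finite.mem_toFinset, mem_insert_iff, not_or] at hxP
  have hjump : ¬ DifferentiableAt ℝ u (Y x) → Fuzzy.conv u ζ x ∉ jumpLevels u (Y x) :=
    fun h1 h2 => hxP.2 (mem_biUnion h1 h2)
  have hfc : ContinuousAt (Fuzzy.conv u ζ) x := hcont.continuousAt hS
  have hreg : DifferentiableAt ℝ u (Y x) → ∀ᶠ t in 𝓝 x, ContinuousAt u (Y t) := by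
    intro h1
    have hYc : ContinuousAt Y x := by
      have : Tendsto (fun t : ℝ => t - x) (𝓝 x) (𝓝 0) := by
        have : ContinuousAt (fun t : ℝ => t - x) x := by fun_prop
        simpa [ContinuousAt] using this
      simpa [ContinuousAt] using (hYO.trans_tendsto this).add_const (Y x)
    -- The bad set is finite, hence closed, so `u` stays differentiable at `Y t` for `t` near `x`.
    -- Continuity is needed at these neighbouring points to get `f = u ∘ Y` on a neighbourhood.
    have h2 := hYc.eventually (hfin.isClosed.isOpen_compl.mem_nhds (not_not_intro h1))
    filter_upwards [h2] with t ht using (not_not.1 ht).continuousAt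
  have key : (DifferentiableAt ℝ u (Y x) → Fuzzy.conv u ζ =ᶠ[𝓝 x] fun t => u (Y t)) ∧
      (¬ DifferentiableAt ℝ u (Y x) → ∀ᶠ t in 𝓝 x, Y t = Y x) := by
    have hside : x < lower (Fuzzy.conv u ζ) 1 ∨ upper (Fuzzy.conv u ζ) 1 < x := by
      by_contra! hcon
      exact hxP.1 (hf.apply_eq_one_of_mem hcon.1 hcon.2)
    have hcore := hf.lower_le_upper IsFuzzyNumber.one_mem_unit
    rcases hside with hside | hside
    · have hL : ∀ᶠ t in 𝓝 x, LeftLevel u (Y t) (Fuzzy.conv u ζ t) := by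
        filter_upwards [hS, Iio_mem_nhds hside] with t ht h1
        exact (h.left t ht (h1.le.trans hcore)).1
      constructor
      · intro h1
        filter_upwards [hL, hreg h1] with t ht hc
        exact (ht.eq_of_continuousWithinAt hu (hf.nonneg t) (sub_one_lt _)
          hc.continuousWithinAt).symm
      · intro h1
        filter_upwards [hL, hfc.eventually
          (hL.self_of_nhds.eventually_eq hu hα.1 (hjump h1))] with t ht h2
        exact h2 (hf.nonneg t) _ ht
    · have hR : ∀ᶠ t in 𝓝 x, RightLevel u (Y t) (Fuzzy.conv u ζ t) := by
        filter_upwards [hS, Ioi_mem_nhds hside] with t ht h1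
        exact (h.right t ht (hcore.trans h1.le)).1
      constructor
      · intro h1
        filter_upwards [hR, hreg h1] with t ht hc
        exact (ht.eq_of_continuousAt hu (hf.nonneg t) hc).symm
      · intro h1
        filter_upwards [hR, hfc.eventually
          (hR.self_of_nhds.eventually_eq hu hα.1 (hjump h1))] with t ht h2
        exact h2 (hf.nonneg t) _ ht
  have hζx := (hζ.differentiableAt _ hZx).hasDerivAt
  by_cases hd : DifferentiableAt ℝ u (Y x)
  · refine differentiableAt_of_eq_comp (c := 1) hZO hYO (Eventually.of_forall fun t => ?_)
      hζx hd.hasDerivAt hfv (key.1 hd)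
    linear_combination -h.add_eq t + h.add_eq x
  -- Inside a jump of `u` the component `Y` is frozen, and `ζ` alone carries the variation of the
  -- convolution.
  · have hshift : Fuzzy.conv u ζ =ᶠ[𝓝 x] fun t => ζ (t - Y x) := by
      filter_upwards [hfv, key.2 hd] with t ht hY
      rw [ht, ← hY]
      congr 1
      linarith [h.add_eq t]
    refine DifferentiableAt.congr_of_eventuallyEq ?_ hshift
    have : x - Y x = Z x := by linarith [h.add_eq x]
    refine DifferentiableAt.comp x (this ▸ hζx.differentiableAt) (by fun_prop)

end Fuzzy

theorem mainTheorem1 (u : ℝ → ℝ) (hu : Fuzzy.IsFuzzyNumber u)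
    (hfin : {x : ℝ | ¬ DifferentiableAt ℝ u x}.Finite) :
    (∃ ζ : ℝ → ℝ, Fuzzy.IsSmoother u ζ ∧ Fuzzy.EndpointLE ζ u) ∧
    (∀ ζ : ℝ → ℝ, Fuzzy.IsSmoother u ζ → Fuzzy.EndpointLE ζ u →
      ∀ p : ℝ, 0 < p → Fuzzy.IsSmoother u (Fuzzy.scale p ζ)) ∧
    (∀ ζ : ℝ → ℝ, Fuzzy.IsSmoother u ζ →
      (∀ p : ℝ, 0 < p →
        Fuzzy.IsFuzzyNumber (Fuzzy.conv u (Fuzzy.scale p ζ)) ∧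
        Fuzzy.supDist u (Fuzzy.conv u (Fuzzy.scale p ζ)) ≤
          p * max |Fuzzy.upper ζ 0| |Fuzzy.lower ζ 0|) ∧
      Filter.Tendsto (fun p : ℝ => Fuzzy.supDist u (Fuzzy.conv u (Fuzzy.scale p ζ)))
        (nhdsWithin 0 (Set.Ioi 0)) (nhds 0)) := by
  refine ⟨Fuzzy.exists_isSmoother hu hfin, fun ζ hζ he p hp => hζ.scale hu he hp,
    fun ζ hζ => ⟨fun p hp => ⟨hu.conv (hζ.1.isFuzzyNumber.scale hp),
      Fuzzy.supDist_conv_scale_le hu hζ.1.isFuzzyNumber hp⟩,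
      Fuzzy.tendsto_supDist_conv_scale hu hζ.1.isFuzzyNumber⟩⟩
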